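/- Let $\mathcal C$ be a Barr-exact category, i.e. a category with finite limits in which every kernel pair has a coequalizer, regular epimorphisms are stable under pullback, and every internal equivalence relation is a kernel pair. For an internal groupoid $\mathbb H$ in $\mathcal C$, with domain and codomain morphisms $d,c\colon H_1\to H_0$, let $$H_1\xrightarrow{\ \sigma_H\ }\Sigma H_1\xrightarrow{(r_1,r_2)}H_0\times H_0$$ be the factorization of $(d,c)$ as a regular epimorphism followed by a monomorphism. The pair $(r_1,r_2)$ is an equivalence relation on $H_0$, the support of $\mathbb H$; let $\pi_0(\mathbb H)$ be its quotient, i.e. the coequalizer of $r_1$ and $r_2$. An internal functor $F=(f_0,f_1)\colon\mathbb H\to\mathbb G$ induces morphisms $\Sigma f_1\colon\Sigma H_1\to\Sigma G_1$, with $\Sigma f_1\cdot\sigma_H=\sigma_G\cdot f_1$, and $\pi_0(F)\colon\pi_0(\mathbb H)\to\pi_0(\mathbb G)$, and hence a comparison morphism $$\psi_F=(\sigma_H,f_1)\colon H_1\to \Sigma H_1\times_{\Sigma G_1}G_1$$ into the pullback of $\Sigma f_1$ and $\sigma_G$. An internal functor $K=(k_0,k_1)\colon\mathbb X\to\mathbb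 Y$ between internal groupoids is a discrete fibration if the square $c\cdot k_1=k_0\cdot c$ is a pullback. The functor $F$ is called final if it is left orthogonal to all discrete fibrations between internal groupoids in $\mathcal C$: for every discrete fibration $K\colon\mathbb X\to\mathbb Y$ and all internal functors $U\colon\mathbb H\to\mathbb X$, $V\colon\mathbb G\to\mathbb Y$ with $KU=VF$, there is a unique internal functor $L\colon\mathbb G\to\mathbb X$ with $LF=U$ and $KL=V$. Then an internal functor $F\colon\mathbb H\to\mathbb G$ between internal groupoids in $\mathcal C$ is final if and only if both of the following conditions hold: (i) $\pi_0(F)$ is an isomorphism; (ii) $\psi_F\colon H_1\to \Sigma H_1\times_{\Sigma G_1}G_1$ is a regular epimorphism. -/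

import Mathlib

open CategoryTheory CategoryTheory.Limits

universe v u

/-- A Barr-exact category: a regular category in which every internal equivalence relation is
effective, i.e. is the kernel pair of some morphism. -/
class BarrExact (C : Type u) [Category.{v} C] extends Regular C where
  exists_isKernelPair {R X : C} (p₁ p₂ : R ⟶ X) :
    IsEquivalenceRelation p₁ p₂ → ∃ (Y : C) (f : X ⟶ Y), IsKernelPair f p₁ p₂

/-- An internal groupoid in `C`. The morphism `d` is the domain, `c` the codomain, `e` the
identities, `m` the composition (of a composable pair: first arrow, then second arrow),
`i` the inversion. Associativity is expressed for generalized elements. -/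
structure InternalGroupoid (C : Type u) [Category.{v} C] [HasPullbacks C] where
  /-- the object of objects -/
  obj : C
  /-- the object of arrows -/
  arr : C
  d : arr ⟶ obj
  c : arr ⟶ obj
  e : obj ⟶ arr
  m : pullback c d ⟶ arr
  i : arr ⟶ arr
  e_d : e ≫ d = 𝟙 obj
  e_c : e ≫ c = 𝟙 obj
  m_d : m ≫ d = pullback.fst c d ≫ d
  m_c : m ≫ c = pullback.snd c d ≫ c
  id_m : pullback.lift (d ≫ e) (𝟙 arr) (by simp [e_c]) ≫ m = 𝟙 arr
  m_id : pullback.lift (𝟙 arr) (c ≫ e) (by simp [e_d]) ≫ m = 𝟙 arr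
  assoc : ∀ {T : C} (x y z : T ⟶ arr) (hxy : x ≫ c = y ≫ d) (hyz : y ≫ c = z ≫ d),
    pullback.lift (pullback.lift x y hxy ≫ m) z
        (by rw [Category.assoc, m_c, pullback.lift_snd_assoc, hyz]) ≫ m =
      pullback.lift x (pullback.lift y z hyz ≫ m)
        (by rw [Category.assoc, m_d, pullback.lift_fst_assoc, hxy]) ≫ m
  i_d : i ≫ d = c
  i_c : i ≫ c = d
  m_inv : pullback.lift (𝟙 arr) i (by simp [i_d]) ≫ m = d ≫ e
  inv_m : pullback.lift i (𝟙 arr) (by simp [i_c]) ≫ m = c ≫ e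

namespace InternalGroupoid

section Functors

variable {C : Type u} [Category.{v} C] [HasPullbacks C]

/-- An internal functor between internal groupoids. -/
@[ext]
structure Hom (H G : InternalGroupoid C) where
  f₀ : H.obj ⟶ G.obj
  f₁ : H.arr ⟶ G.arr
  d_comm : H.d ≫ f₀ = f₁ ≫ G.d
  c_comm : H.c ≫ f₀ = f₁ ≫ G.c
  e_comm : H.e ≫ f₁ = f₀ ≫ G.e
  m_comm : H.m ≫ f₁ =
    pullback.lift (pullback.fst H.c H.d ≫ f₁) (pullback.snd H.c H.d ≫ f₁)
      (by rw [Category.assoc, Category.assoc, ← c_comm, ← d_comm, pullback.condition_assoc]) ≫ G.m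

/-- The category `Gpd(C)` of internal groupoids in `C` and internal functors. -/
instance : Category (InternalGroupoid C) where
  Hom := Hom
  id H :=
    { f₀ := 𝟙 _
      f₁ := 𝟙 _
      d_comm := by simp
      c_comm := by simp
      e_comm := by simp
      m_comm := by simp }
  comp F K :=
    { f₀ := F.f₀ ≫ K.f₀
      f₁ := F.f₁ ≫ K.f₁
      d_comm := by rw [← Category.assoc, F.d_comm, Category.assoc, K.d_comm, Category.assoc]
      c_comm := by rw [← Category.assoc, F.c_comm, Category.assoc, K.c_comm, Category.assoc]
      e_comm := by rw [← Category.assoc, F.e_comm, Category.assoc, K.e_comm, Category.assoc]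
      m_comm := by
        rw [← Category.assoc, F.m_comm, Category.assoc, K.m_comm, ← Category.assoc]
        congr 1
        apply pullback.hom_ext
        · rw [Category.assoc, pullback.lift_fst, pullback.lift_fst, pullback.lift_fst_assoc,
            Category.assoc]
        · rw [Category.assoc, pullback.lift_snd, pullback.lift_snd, pullback.lift_snd_assoc,
            Category.assoc] }
  id_comp F := Hom.ext (Category.id_comp _) (Category.id_comp _)
  comp_id F := Hom.ext (Category.comp_id _) (Category.comp_id _)
  assoc F K L := Hom.ext (Category.assoc _ _ _) (Category.assoc _ _ _)

@[simp]
lemma id_f₀ (H : InternalGroupoid C) : Hom.f₀ (𝟙 H) = 𝟙 H.obj := rfl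

@[simp]
lemma comp_f₀ {H G K : InternalGroupoid C} (F : H ⟶ G) (L : G ⟶ K) :
    Hom.f₀ (F ≫ L) = F.f₀ ≫ L.f₀ := rfl

/-- An internal functor is a discrete fibration if the square formed by its components and the
codomain morphisms is a pullback. -/
def IsDiscreteFibration {H G : InternalGroupoid C} (F : H ⟶ G) : Prop :=
  IsPullback F.f₁ H.c G.c F.f₀

/-- An internal functor between groupoids is final if it is (left) orthogonal to every discrete
fibration of internal groupoids: each commutative square from it to a discrete fibration has
exactly one diagonal. -/
def IsFinal {H G : InternalGroupoid C} (F : H ⟶ G) : Prop :=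
  ∀ ⦃X Y : InternalGroupoid C⦄ (K : X ⟶ Y), IsDiscreteFibration K →
    ∀ (U : H ⟶ X) (V : G ⟶ Y), U ≫ K = F ≫ V →
      ∃! L : G ⟶ X, F ≫ L = U ∧ L ≫ K = V

end Functors

noncomputable section Support

variable {C : Type u} [Category.{v} C]

section Reg

variable [Regular C] (H : InternalGroupoid C)

/-- The object `ΣH₁`: the (regular) image of `(d, c) : H₁ ⟶ H₀ × H₀`. -/
def supp : C := image (prod.lift H.d H.c)

/-- The (regular epi) part `σ_H : H₁ ⟶ ΣH₁` of the image factorization of `(d, c)`. -/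
def σ : H.arr ⟶ H.supp := factorThruImage (prod.lift H.d H.c)

/-- The (mono) part `ΣH₁ ⟶ H₀ × H₀` of the image factorization of `(d, c)`. -/
def suppι : H.supp ⟶ H.obj ⨯ H.obj := image.ι (prod.lift H.d H.c)

/-- The first projection of the support. -/
def r₁ : H.supp ⟶ H.obj := H.suppι ≫ prod.fst

/-- The second projection of the support. -/
def r₂ : H.supp ⟶ H.obj := H.suppι ≫ prod.snd

instance : Mono H.suppι := inferInstanceAs (Mono (image.ι _))

instance : StrongEpi H.σ := inferInstanceAs (StrongEpi (factorThruImage _))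

instance : IsRegularEpi H.σ := inferInstance

lemma σ_suppι : H.σ ≫ H.suppι = prod.lift H.d H.c := image.fac _

lemma σ_r₁ : H.σ ≫ H.r₁ = H.d := by
  rw [r₁, ← Category.assoc, σ_suppι, prod.lift_fst]

lemma σ_r₂ : H.σ ≫ H.r₂ = H.c := by
  rw [r₂, ← Category.assoc, σ_suppι, prod.lift_snd]

lemma supp_hom_ext {T : C} {x y : T ⟶ H.supp} (h₁ : x ≫ H.r₁ = y ≫ H.r₁)
    (h₂ : x ≫ H.r₂ = y ≫ H.r₂) : x = y := by
  rw [← cancel_mono H.suppι]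
  apply Limits.prod.hom_ext
  · simpa [r₁] using h₁
  · simpa [r₂] using h₂

/-- A pair of generalized objects which is covered (along a strong epimorphism) by a generalized
arrow belongs to the support. -/
lemma exists_supp_lift {S T : C} (p : S ⟶ T) [StrongEpi p] (x y : T ⟶ H.obj) (a : S ⟶ H.arr)
    (hd : a ≫ H.d = p ≫ x) (hc : a ≫ H.c = p ≫ y) :
    ∃ t : T ⟶ H.supp, t ≫ H.r₁ = x ∧ t ≫ H.r₂ = y := by
  have sq : CommSq (a ≫ H.σ) p H.suppι (prod.lift x y) := ⟨by
    rw [Category.assoc, σ_suppι]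
    apply Limits.prod.hom_ext <;> simp [hd, hc]⟩
  refine ⟨sq.lift, ?_, ?_⟩
  · rw [r₁, ← Category.assoc, sq.fac_right, prod.lift_fst]
  · rw [r₂, ← Category.assoc, sq.fac_right, prod.lift_snd]

/-- The support of an internal groupoid is an equivalence relation on the object of objects. -/
lemma supp_isEquivalenceRelation : IsEquivalenceRelation H.r₁ H.r₂ := by
  obtain ⟨s, hs₁, hs₂⟩ := H.exists_supp_lift H.σ H.r₂ H.r₁ H.i
    (by rw [H.i_d, σ_r₂]) (by rw [H.i_c, σ_r₁])
  let P := pullback H.r₂ H.r₁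
  -- cover the object of composable pairs of the support by composable pairs of arrows
  let A := pullback H.σ (pullback.fst H.r₂ H.r₁)
  let B := pullback H.σ (pullback.snd H.σ (pullback.fst H.r₂ H.r₁) ≫ pullback.snd H.r₂ H.r₁)
  let b : B ⟶ A := pullback.snd _ _
  let a : A ⟶ P := pullback.snd _ _
  let x : B ⟶ H.arr := b ≫ pullback.fst _ _
  let y : B ⟶ H.arr := pullback.fst _ _
  have hx : x ≫ H.σ = (b ≫ a) ≫ pullback.fst _ _ := by
    simp only [x, a, Category.assoc, pullback.condition]
  have hy : y ≫ H.σ = (b ≫ a) ≫ pullback.snd _ _ := by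
    simp only [y, a, b, Category.assoc, pullback.condition]
  have hxy : x ≫ H.c = y ≫ H.d := by
    rw [← σ_r₂, ← σ_r₁, ← Category.assoc, hx, ← Category.assoc, hy, Category.assoc,
      pullback.condition, Category.assoc, Category.assoc, Category.assoc]
  have : StrongEpi a := inferInstanceAs (StrongEpi (pullback.snd _ _))
  have : StrongEpi b := inferInstanceAs (StrongEpi (pullback.snd _ _))
  have : StrongEpi (b ≫ a) := strongEpi_comp _ _
  obtain ⟨t, ht₁, ht₂⟩ := H.exists_supp_lift (b ≫ a) (pullback.fst H.r₂ H.r₁ ≫ H.r₁)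
    (pullback.snd H.r₂ H.r₁ ≫ H.r₂) (pullback.lift x y hxy ≫ H.m)
    (by rw [Category.assoc, H.m_d, ← Category.assoc, pullback.lift_fst, ← σ_r₁,
      ← Category.assoc, hx, Category.assoc])
    (by rw [Category.assoc, H.m_c, ← Category.assoc, pullback.lift_snd, ← σ_r₂,
      ← Category.assoc, hy, Category.assoc])
  exact ⟨⟨{
    right_cancellation := fun _ _ _ h₁ h₂ => H.supp_hom_ext h₁ h₂
    r := H.e ≫ H.σ
    reflexivity₁ := by rw [Category.assoc, σ_r₁, H.e_d]
    reflexivity₂ := by rw [Category.assoc, σ_r₂, H.e_c]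
    s := s
    symmetry₁ := hs₁
    symmetry₂ := hs₂
    c := pullback.cone H.r₂ H.r₁
    isLimit := pullback.isLimit H.r₂ H.r₁
    t := t
    transitivity₁ := ht₁
    transitivity₂ := ht₂ }⟩⟩

variable {H} {G : InternalGroupoid C} (F : H ⟶ G)

lemma suppMap_commSq :
    CommSq (F.f₁ ≫ G.σ) H.σ G.suppι (H.suppι ≫ prod.map F.f₀ F.f₀) := ⟨by
  rw [Category.assoc, σ_suppι, ← Category.assoc, σ_suppι]
  apply Limits.prod.hom_ext <;> simp [F.d_comm, F.c_comm]⟩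

/-- The morphism `Σf₁ : ΣH₁ ⟶ ΣG₁` induced by an internal functor. -/
def suppMap : H.supp ⟶ G.supp := (suppMap_commSq F).lift

lemma σ_suppMap : H.σ ≫ suppMap F = F.f₁ ≫ G.σ := (suppMap_commSq F).fac_left

lemma suppMap_suppι : suppMap F ≫ G.suppι = H.suppι ≫ prod.map F.f₀ F.f₀ :=
  (suppMap_commSq F).fac_right

lemma suppMap_r₁ : suppMap F ≫ G.r₁ = H.r₁ ≫ F.f₀ := by
  simp only [r₁, ← Category.assoc, suppMap_suppι]
  simp

lemma suppMap_r₂ : suppMap F ≫ G.r₂ = H.r₂ ≫ F.f₀ := by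
  simp only [r₂, ← Category.assoc, suppMap_suppι]
  simp

/-- The comparison morphism `ψ_F : H₁ ⟶ ΣH₁ ×_{ΣG₁} G₁`, with components `σ_H` and `f₁`. -/
def ψ : H.arr ⟶ pullback (suppMap F) G.σ :=
  pullback.lift H.σ F.f₁ (σ_suppMap F)

end Reg

variable [BarrExact C]

instance (H : InternalGroupoid C) : HasCoequalizer H.r₁ H.r₂ := by
  obtain ⟨_, _, h⟩ := BarrExact.exists_isKernelPair _ _ H.supp_isEquivalenceRelation
  exact Regular.hasCoequalizer_of_isKernelPair h

/-- The connected components functor `π₀ : Gpd(C) ⥤ C`, sending a groupoid to the quotient of its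
support, and a functor to the induced morphism between the quotients. -/
def π₀ : InternalGroupoid C ⥤ C where
  obj H := coequalizer H.r₁ H.r₂
  map {H G} F := coequalizer.desc (F.f₀ ≫ coequalizer.π G.r₁ G.r₂) (by
    rw [← Category.assoc, ← Category.assoc, ← suppMap_r₁, ← suppMap_r₂, Category.assoc,
      Category.assoc, coequalizer.condition])
  map_id H := by
    apply coequalizer.hom_ext
    simp
  map_comp F K := by
    apply coequalizer.hom_ext
    simp

end Support

end InternalGroupoid

-- The argument uses generalized elements: a regular (equivalently, strong) epimorphism is a cover,
-- and "locally" means after restriction along one. Composition is written in diagrammatic order.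
-- Exactness makes the support the kernel pair of the quotient, so two objects lie in the same
-- component iff they are locally joined by an arrow. Hence (i) says that `F` is locally essentially
-- surjective and reflects connectedness, and, given (i), (ii) says that `F` is locally full: every
-- g : F x → F y is locally the image of an arrow x → y.
--
-- Sufficiency. Along a discrete fibration an arrow lifts uniquely once its codomain is lifted. Each
-- object of `G` is locally the domain of some γ with codomain F h, so a diagonal must send it to
-- the domain of the lift of V γ ending at U h. Local fullness makes this independent of γ and h, so
-- it descends to all of `G`.
--
-- Necessity. Orthogonality to discrete groupoids over the terminal one says that
-- component-invariant morphisms extend uniquely along `F`, which gives (i). For local fullness the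
-- test is the second factor of the comprehensive factorization: its fibre over z consists of the
-- classes [h, γ : F h → z], where [h, F η · γ] = [h', γ] for η : h → h', and k transports [h, γ] to
-- [h, γ · k⁻¹]. Finality gives a section with value [h, 1] at F h. For g : F x → F y, compatibility
-- with transport reads [x, 1] = [y, g⁻¹], so locally some η : x → y satisfies F η · g⁻¹ = 1, that
-- is, F η = g. Finality of the first factor is not needed.

attribute [local simp] pullback.lift_fst pullback.lift_snd pullback.lift_fst_assoc
  pullback.lift_snd_assoc

/-! ### Local arguments in a regular category -/

namespace CategoryTheory.Regular

variable {C : Type u} [Category.{v} C] [Regular C]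

/-- A generalized element of the target of a strong epimorphism lifts along a cover. -/
lemma exists_cover_lift {A B T : C} (q : A ⟶ B) [StrongEpi q] (x : T ⟶ B) :
    ∃ (S : C) (p : S ⟶ T) (_ : StrongEpi p) (z : S ⟶ A), z ≫ q = p ≫ x :=
  ⟨_, pullback.snd q x, inferInstance, pullback.fst q x, pullback.condition⟩

/-- A morphism descends along a strong epimorphism if it locally identifies the generalized
elements which the strong epimorphism identifies. -/
lemma exists_descent {A B Z : C} (q : A ⟶ B) [StrongEpi q] (f : A ⟶ Z)
    (h : ∀ ⦃T : C⦄ (a b : T ⟶ A), a ≫ q = b ≫ q →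
      ∃ (S : C) (p : S ⟶ T) (_ : StrongEpi p), p ≫ a ≫ f = p ≫ b ≫ f) :
    ∃ g : B ⟶ Z, q ≫ g = f := by
  refine IsRegularEpi.exists_of_isKernelPair q (IsKernelPair.of_hasPullback q) f ?_
  obtain ⟨S, p, _, hp⟩ := h _ _ (pullback.condition (f := q) (g := q))
  exact (cancel_epi p).1 hp

end CategoryTheory.Regular

namespace InternalGroupoid

/-! ### Calculus of generalized arrows in a groupoid -/

noncomputable section Elements

variable {C : Type u} [Category.{v} C] [HasPullbacks C] (G : InternalGroupoid C)

/-- The composite of two composable generalized arrows. -/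
def mul {T : C} (x y : T ⟶ G.arr) (h : x ≫ G.c = y ≫ G.d) : T ⟶ G.arr :=
  pullback.lift x y h ≫ G.m

variable {G}

lemma mul_d {T : C} (x y : T ⟶ G.arr) (h : x ≫ G.c = y ≫ G.d) :
    G.mul x y h ≫ G.d = x ≫ G.d := by
  rw [mul, Category.assoc, G.m_d, pullback.lift_fst_assoc]

lemma mul_c {T : C} (x y : T ⟶ G.arr) (h : x ≫ G.c = y ≫ G.d) :
    G.mul x y h ≫ G.c = y ≫ G.c := by
  rw [mul, Category.assoc, G.m_c, pullback.lift_snd_assoc]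

lemma precomp_mul {S T : C} (t : S ⟶ T) (x y : T ⟶ G.arr) (h : x ≫ G.c = y ≫ G.d) :
    t ≫ G.mul x y h = G.mul (t ≫ x) (t ≫ y) (by simp [h]) := by
  rw [mul, mul, ← Category.assoc]
  congr 1
  apply pullback.hom_ext <;> simp

lemma mul_congr {T : C} {x x' y y' : T ⟶ G.arr} (h : x ≫ G.c = y ≫ G.d) (hx : x = x')
    (hy : y = y') : G.mul x y h = G.mul x' y' (by rw [← hx, ← hy, h]) := by
  subst hx hy; rfl

lemma mul_assoc {T : C} (x y z : T ⟶ G.arr) (hxy : x ≫ G.c = y ≫ G.d)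
    (hyz : y ≫ G.c = z ≫ G.d) :
    G.mul (G.mul x y hxy) z ((mul_c x y hxy).trans hyz) =
      G.mul x (G.mul y z hyz) (hxy.trans (mul_d y z hyz).symm) :=
  G.assoc x y z hxy hyz

lemma mul_of_eq_id_left {T : C} {x y : T ⟶ G.arr} (h : x ≫ G.c = y ≫ G.d)
    (hx : x = y ≫ G.d ≫ G.e) : G.mul x y h = y := by
  have := congr_arg (y ≫ ·) G.id_m
  simp only [Category.comp_id] at this
  refine Eq.trans ?_ this
  rw [mul, ← Category.assoc]
  congr 1
  apply pullback.hom_ext <;> simp [hx]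

lemma mul_of_eq_id_right {T : C} {x y : T ⟶ G.arr} (h : x ≫ G.c = y ≫ G.d)
    (hy : y = x ≫ G.c ≫ G.e) : G.mul x y h = x := by
  have := congr_arg (x ≫ ·) G.m_id
  simp only [Category.comp_id] at this
  refine Eq.trans ?_ this
  rw [mul, ← Category.assoc]
  congr 1
  apply pullback.hom_ext <;> simp [hy]

lemma mul_inv_self {T : C} (x : T ⟶ G.arr) :
    G.mul x (x ≫ G.i) (by simp [G.i_d]) = x ≫ G.d ≫ G.e := by
  rw [← G.m_inv, mul, ← Category.assoc x (pullback.lift _ _ _)]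
  congr 1
  apply pullback.hom_ext <;> simp

lemma inv_mul_self {T : C} (x : T ⟶ G.arr) :
    G.mul (x ≫ G.i) x (by simp [G.i_c]) = x ≫ G.c ≫ G.e := by
  rw [← G.inv_m, mul, ← Category.assoc x (pullback.lift _ _ _)]
  congr 1
  apply pullback.hom_ext <;> simp

lemma mul_inv_mul_cancel {T : C} (x y : T ⟶ G.arr) (h : x ≫ G.d = y ≫ G.d) :
    G.mul x (G.mul (x ≫ G.i) y (by simp [G.i_c, h])) (by simp [mul_d, G.i_d]) = y := by
  rw [← mul_assoc x (x ≫ G.i) y (by simp [G.i_d]) (by simp [G.i_c, h])]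
  exact mul_of_eq_id_left _ (by rw [mul_inv_self, reassoc_of% h])

lemma mul_left_cancel {T : C} {x y z : T ⟶ G.arr} (hy : x ≫ G.c = y ≫ G.d)
    (hz : x ≫ G.c = z ≫ G.d) (h : G.mul x y hy = G.mul x z hz) : y = z := by
  have key : ∀ (w : T ⟶ G.arr) (hw : x ≫ G.c = w ≫ G.d),
      G.mul (x ≫ G.i) (G.mul x w hw) (by simp [mul_d, G.i_c]) = w := by
    intro w hw
    rw [← mul_assoc (x ≫ G.i) x w (by simp [G.i_c]) hw]
    exact mul_of_eq_id_left _ (by rw [inv_mul_self, reassoc_of% hw])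
  rw [← key y hy, ← key z hz]
  exact mul_congr _ rfl h

/-- A right inverse of a generalized arrow is its inverse. -/
lemma eq_inv_of_mul_eq {T : C} {x y : T ⟶ G.arr} (h : x ≫ G.c = y ≫ G.d)
    (hxy : G.mul x y h = x ≫ G.d ≫ G.e) : y = x ≫ G.i :=
  mul_left_cancel h (by simp [G.i_d]) (hxy.trans (mul_inv_self x).symm)

lemma inv_of_id (G : InternalGroupoid C) : G.e ≫ G.i = G.e :=
  (eq_inv_of_mul_eq (x := G.e) (y := G.e) (by rw [G.e_c, G.e_d])
    (mul_of_eq_id_right _ (by rw [reassoc_of% G.e_c]) |>.trans (by rw [reassoc_of% G.e_d]))).symm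

lemma i_i (G : InternalGroupoid C) : G.i ≫ G.i = 𝟙 G.arr :=
  (eq_inv_of_mul_eq (x := G.i) (y := 𝟙 G.arr) (by simp [G.i_c])
    (by rw [reassoc_of% G.i_d]; exact G.inv_m)).symm

lemma inv_mul {T : C} (x y : T ⟶ G.arr) (h : x ≫ G.c = y ≫ G.d) :
    G.mul x y h ≫ G.i = G.mul (y ≫ G.i) (x ≫ G.i) (by simp [G.i_c, G.i_d, h]) := by
  symm
  apply eq_inv_of_mul_eq (by simp [mul_c, mul_d, G.i_d])
  rw [mul_assoc x y _ h (by simp [mul_d, G.i_d])]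
  rw [mul_congr (x' := x) (y' := x ≫ G.i) _ rfl, mul_inv_self, reassoc_of% mul_d x y h]
  rw [← mul_assoc y (y ≫ G.i) (x ≫ G.i) (by simp [G.i_d]) (by simp [G.i_c, G.i_d, h])]
  exact mul_of_eq_id_left _ (by simp [mul_inv_self, reassoc_of% G.i_d, reassoc_of% h])

lemma mul_f₁ {H : InternalGroupoid C} (F : H ⟶ G) {T : C} (x y : T ⟶ H.arr)
    (h : x ≫ H.c = y ≫ H.d) :
    H.mul x y h ≫ F.f₁ = G.mul (x ≫ F.f₁) (y ≫ F.f₁)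
      (by simp [← F.c_comm, ← F.d_comm, reassoc_of% h]) := by
  rw [mul, mul, Category.assoc, F.m_comm, ← Category.assoc]
  congr 1
  apply pullback.hom_ext <;> simp

@[simp]
lemma comp_f₁ {H K : InternalGroupoid C} (F : H ⟶ G) (L : G ⟶ K) :
    Hom.f₁ (F ≫ L) = F.f₁ ≫ L.f₁ := rfl

lemma hom_ext {H : InternalGroupoid C} {F F' : H ⟶ G} (h₀ : F.f₀ = F'.f₀)
    (h₁ : F.f₁ = F'.f₁) : F = F' :=
  Hom.ext h₀ h₁

/-- Functoriality with respect to composition, tested on the generic composable pair. -/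
lemma m_comm_of_mul {H : InternalGroupoid C} (f₁ : H.arr ⟶ G.arr)
    (h : (pullback.fst H.c H.d ≫ f₁) ≫ G.c = (pullback.snd H.c H.d ≫ f₁) ≫ G.d)
    (hm : H.mul (pullback.fst _ _) (pullback.snd _ _) pullback.condition ≫ f₁ =
      G.mul (pullback.fst H.c H.d ≫ f₁) (pullback.snd H.c H.d ≫ f₁) h) :
    H.m ≫ f₁ = pullback.lift (pullback.fst H.c H.d ≫ f₁) (pullback.snd H.c H.d ≫ f₁) h ≫ G.m := by
  refine Eq.trans ?_ hm
  rw [mul]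
  congr 1
  refine Eq.trans (Category.id_comp _).symm ?_
  congr 1
  apply pullback.hom_ext <;> simp

/-! ### Unique lifting along discrete fibrations -/

namespace IsDiscreteFibration

variable {X Y : InternalGroupoid C} {K : X ⟶ Y}

/-- The uniqueness half of the pullback property. It is the standard way to compare arrows upstairs:
check their images under `K` and their codomains. -/
lemma arr_ext (hK : IsDiscreteFibration K) {T : C} {x y : T ⟶ X.arr} (h₁ : x ≫ K.f₁ = y ≫ K.f₁)
    (hc : x ≫ X.c = y ≫ X.c) : x = y :=
  IsPullback.hom_ext hK h₁ hc

/-- A functor into the total groupoid of a discrete fibration is determined by its composite with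
the fibration and its action on objects. -/
lemma hom_ext (hK : IsDiscreteFibration K) {L L' : G ⟶ X} (h : L ≫ K = L' ≫ K)
    (h₀ : L.f₀ = L'.f₀) : L = L' := by
  refine InternalGroupoid.hom_ext h₀ (hK.arr_ext ?_ ?_)
  · rw [← comp_f₁, ← comp_f₁, h]
  · rw [← L.c_comm, ← L'.c_comm, h₀]

/-- A morphism of graphs which lifts an internal functor along a discrete fibration is an internal
functor. -/
lemma exists_lift (hK : IsDiscreteFibration K) (V : G ⟶ Y) (l₀ : G.obj ⟶ X.obj)
    (l₁ : G.arr ⟶ X.arr) (h₀ : l₀ ≫ K.f₀ = V.f₀) (h₁ : l₁ ≫ K.f₁ = V.f₁)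
    (hd : G.d ≫ l₀ = l₁ ≫ X.d) (hc : G.c ≫ l₀ = l₁ ≫ X.c) : ∃ L : G ⟶ X, L.f₀ = l₀ ∧ L ≫ K = V := by
  refine ⟨⟨l₀, l₁, hd, hc, ?_, ?_⟩, rfl, InternalGroupoid.hom_ext h₀ h₁⟩
  · apply hK.arr_ext
    · rw [Category.assoc, h₁, Category.assoc, K.e_comm, V.e_comm, reassoc_of% h₀]
    · rw [Category.assoc, ← hc, Category.assoc, X.e_c, reassoc_of% G.e_c, Category.comp_id]
  · apply m_comm_of_mul
    apply hK.arr_ext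
    · rw [Category.assoc, h₁, mul_f₁, mul_f₁]
      exact mul_congr _ (by simp [h₁]) (by simp [h₁])
    · rw [mul_c, Category.assoc, Category.assoc, ← hc, reassoc_of% mul_c]

end IsDiscreteFibration

end Elements

/-! ### Connected components -/

noncomputable section Components

variable {C : Type u} [Category.{v} C] [BarrExact C] (H : InternalGroupoid C)

/-- The quotient morphism from the object of objects to the object of connected components. -/
def toπ₀ : H.obj ⟶ π₀.obj H := coequalizer.π H.r₁ H.r₂

instance : IsRegularEpi H.toπ₀ := inferInstanceAs (IsRegularEpi (coequalizer.π H.r₁ H.r₂))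

/-- By exactness the support is the kernel pair of some f. Since f factors through the quotient, any
pair identified by the quotient is identified by f, hence lies in the support. -/
lemma toπ₀_isKernelPair : IsKernelPair H.toπ₀ H.r₁ H.r₂ := by
  obtain ⟨Y, f, h⟩ := BarrExact.exists_isKernelPair _ _ H.supp_isEquivalenceRelation
  refine IsKernelPair.cancel_right (f₂ := coequalizer.desc f h.w) (coequalizer.condition _ _) ?_
  have hf : H.toπ₀ ≫ coequalizer.desc f h.w = f := coequalizer.π_desc _ _
  exact hf.symm ▸ h

lemma d_toπ₀ : H.d ≫ H.toπ₀ = H.c ≫ H.toπ₀ := by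
  rw [← σ_r₁, ← σ_r₂, Category.assoc, Category.assoc, H.toπ₀_isKernelPair.w]

lemma toπ₀_naturality {H G : InternalGroupoid C} (F : H ⟶ G) :
    H.toπ₀ ≫ π₀.map F = F.f₀ ≫ G.toπ₀ :=
  coequalizer.π_desc _ _

variable {H}

/-- A morphism which identifies domains and codomains factors through the connected components. -/
lemma exists_π₀_desc {A : C} (f : H.obj ⟶ A) (hf : H.d ≫ f = H.c ≫ f) :
    ∃ g : π₀.obj H ⟶ A, H.toπ₀ ≫ g = f := by
  have h : H.r₁ ≫ f = H.r₂ ≫ f := by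
    rw [← cancel_epi H.σ, reassoc_of% H.σ_r₁, reassoc_of% H.σ_r₂, hf]
  exact ⟨coequalizer.desc f h, coequalizer.π_desc _ _⟩

/-- Generalized objects in the same connected component are locally connected by an arrow. -/
lemma exists_arr_of_toπ₀_eq {T : C} (x y : T ⟶ H.obj) (h : x ≫ H.toπ₀ = y ≫ H.toπ₀) :
    ∃ (S : C) (p : S ⟶ T) (_ : StrongEpi p) (a : S ⟶ H.arr),
      a ≫ H.d = p ≫ x ∧ a ≫ H.c = p ≫ y := by
  obtain ⟨S, p, hp, a, ha⟩ := Regular.exists_cover_lift H.σ (H.toπ₀_isKernelPair.lift x y h)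
  refine ⟨S, p, hp, a, ?_, ?_⟩
  · rw [← σ_r₁, reassoc_of% ha, IsKernelPair.lift_fst]
  · rw [← σ_r₂, reassoc_of% ha, IsKernelPair.lift_snd]

end Components

/-! ### Discrete groupoids -/

noncomputable section Discrete

variable {C : Type u} [Category.{v} C] [HasPullbacks C]

/-- The discrete internal groupoid on an object. -/
def discrete (A : C) : InternalGroupoid C where
  obj := A
  arr := A
  d := 𝟙 A
  c := 𝟙 A
  e := 𝟙 A
  m := pullback.fst _ _
  i := 𝟙 A
  e_d := by simp
  e_c := by simp
  m_d := by simp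
  m_c := pullback.condition
  id_m := by simp
  m_id := by simp
  assoc _ _ _ _ _ := by simp
  i_d := by simp
  i_c := by simp
  m_inv := by simp
  inv_m := by simp

/-- The functor to a discrete groupoid given by a morphism constant on connected components. -/
def toDiscrete {H : InternalGroupoid C} {A : C} (f : H.obj ⟶ A) (hf : H.d ≫ f = H.c ≫ f) :
    H ⟶ discrete A :=
  { f₀ := f
    f₁ := H.d ≫ f
    d_comm := (Category.comp_id (H.d ≫ f)).symm
    c_comm := hf.symm.trans (Category.comp_id (H.d ≫ f)).symm
    e_comm := by
      dsimp only [discrete]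
      rw [reassoc_of% H.e_d, Category.comp_id]
    m_comm := ((reassoc_of% H.m_d) f).trans (pullback.lift_fst _ _ _).symm }

lemma d_f₀_eq_c_f₀ {H : InternalGroupoid C} {A : C} (L : H ⟶ discrete A) :
    H.d ≫ L.f₀ = H.c ≫ L.f₀ := by
  rw [L.d_comm, L.c_comm]; rfl

lemma hom_discrete_ext {H : InternalGroupoid C} {A : C} {L M : H ⟶ discrete A}
    (h : L.f₀ = M.f₀) : L = M := by
  have key : ∀ N : H ⟶ discrete A, N.f₁ = H.d ≫ N.f₀ := fun N =>
    (Category.comp_id (Y := A) N.f₁).symm.trans N.d_comm.symm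
  exact hom_ext h (by rw [key L, key M, h])

lemma isDiscreteFibration_of_discrete {A B : C} (K : discrete A ⟶ discrete B) :
    IsDiscreteFibration K := by
  have h := K.c_comm
  exact IsPullback.of_vert_isIso (snd := 𝟙 A) (f := 𝟙 B) ⟨h.symm⟩

end Discrete

/-! ### Final functors are bijective on components -/

section FinalConnected

variable {C : Type u} [Category.{v} C] [BarrExact C] {H G : InternalGroupoid C}

/-- Morphisms constant on connected components extend uniquely along final functors. -/
lemma IsFinal.existsUnique_extension {F : H ⟶ G} (hF : IsFinal F) {A : C} (f : H.obj ⟶ A)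
    (hf : H.d ≫ f = H.c ≫ f) :
    ∃! g : G.obj ⟶ A, F.f₀ ≫ g = f ∧ G.d ≫ g = G.c ≫ g := by
  have ext : ∀ {X : InternalGroupoid C} (M N : X ⟶ discrete (⊤_ C)), M = N := fun M N =>
    hom_discrete_ext (Subsingleton.elim (α := _ ⟶ ⊤_ C) _ _)
  obtain ⟨L, ⟨hL, -⟩, huniq⟩ :=
    hF (toDiscrete (terminal.from A) rfl : discrete A ⟶ discrete (⊤_ C))
      (isDiscreteFibration_of_discrete _) (toDiscrete f hf)
      (toDiscrete (terminal.from G.obj) (Subsingleton.elim _ _)) (ext _ _)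
  refine ⟨L.f₀, ⟨congr_arg Hom.f₀ hL, d_f₀_eq_c_f₀ L⟩, fun g hg => ?_⟩
  exact congr_arg Hom.f₀ (huniq (toDiscrete g hg.2) ⟨hom_discrete_ext hg.1, ext _ _⟩)

/-- A final functor induces an isomorphism on connected components. -/
lemma IsFinal.isIso_π₀_map {F : H ⟶ G} (hF : IsFinal F) : IsIso (π₀.map F) := by
  obtain ⟨l, ⟨hl, hl'⟩, -⟩ := hF.existsUnique_extension H.toπ₀ H.d_toπ₀
  obtain ⟨g, hg⟩ := exists_π₀_desc l hl'
  have hg' : π₀.map F ≫ g = 𝟙 _ := by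
    rw [← cancel_epi H.toπ₀, reassoc_of% toπ₀_naturality F, hg, hl, Category.comp_id]
  refine ⟨g, hg', ?_⟩
  rw [← cancel_epi G.toπ₀, Category.comp_id]
  have hd : H.d ≫ F.f₀ ≫ G.toπ₀ = H.c ≫ F.f₀ ≫ G.toπ₀ := by
    rw [reassoc_of% F.d_comm, reassoc_of% F.c_comm, d_toπ₀]
  -- Both sides are component-invariant extensions of the same morphism along `F.f₀`, so the
  -- uniqueness of extensions identifies them.
  refine (hF.existsUnique_extension (F.f₀ ≫ G.toπ₀) hd).unique ⟨?_, ?_⟩ ⟨rfl, G.d_toπ₀⟩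
  · rw [← reassoc_of% toπ₀_naturality F, reassoc_of% hg', toπ₀_naturality]
  · rw [reassoc_of% G.d_toπ₀]

end FinalConnected

/-! ### The two conditions imply finality -/

section Sufficiency

variable {C : Type u} [Category.{v} C] [BarrExact C] {H G : InternalGroupoid C}

/-- If `F` is surjective on connected components, then each generalized object of `G` is locally
the domain of an arrow whose codomain is in the image of `F`. -/
lemma strongEpi_fst_comp_d (F : H ⟶ G) [IsRegularEpi (π₀.map F)] :
    StrongEpi (pullback.fst G.c F.f₀ ≫ G.d) := by
  have : StrongEpi (H.toπ₀ ≫ π₀.map F) := strongEpi_comp _ _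
  obtain ⟨S, p, _, h, hh⟩ := Regular.exists_cover_lift (H.toπ₀ ≫ π₀.map F) G.toπ₀
  obtain ⟨S', p', _, a, had, hac⟩ := exists_arr_of_toπ₀_eq p (h ≫ F.f₀)
    (by rw [← hh, toπ₀_naturality, ← Category.assoc])
  have : StrongEpi (p' ≫ p) := strongEpi_comp _ _
  let t : S' ⟶ pullback G.c F.f₀ := pullback.lift a (p' ≫ h) (by simp [hac])
  have : StrongEpi (t ≫ pullback.fst G.c F.f₀ ≫ G.d) := by simpa [t, had] using this
  exact strongEpi_of_strongEpi t _

/-- If `F` is injective on connected components and `ψ F` is a regular epimorphism, then `F` is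
locally full. -/
lemma exists_arr_lift (F : H ⟶ G) [Mono (π₀.map F)] [IsRegularEpi (ψ F)] {T : C}
    (x y : T ⟶ H.obj) (g : T ⟶ G.arr) (hd : g ≫ G.d = x ≫ F.f₀) (hc : g ≫ G.c = y ≫ F.f₀) :
    ∃ (S : C) (p : S ⟶ T) (_ : StrongEpi p) (a : S ⟶ H.arr),
      a ≫ H.d = p ≫ x ∧ a ≫ H.c = p ≫ y ∧ a ≫ F.f₁ = p ≫ g := by
  have hxy : x ≫ H.toπ₀ = y ≫ H.toπ₀ := by
    rw [← cancel_mono (π₀.map F), Category.assoc, Category.assoc, toπ₀_naturality,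
      ← reassoc_of% hd, ← reassoc_of% hc, d_toπ₀]
  -- Injectivity on components puts (x, y) in the support; together with g it is a point of the
  -- pullback covered by `ψ F`.
  let s := H.toπ₀_isKernelPair.lift x y hxy
  have hs : s ≫ suppMap F = g ≫ G.σ := by
    apply supp_hom_ext
    · rw [Category.assoc, suppMap_r₁, Category.assoc, σ_r₁, hd, IsKernelPair.lift_fst_assoc]
    · rw [Category.assoc, suppMap_r₂, Category.assoc, σ_r₂, hc, IsKernelPair.lift_snd_assoc]
  obtain ⟨S, p, hp, a, ha⟩ := Regular.exists_cover_lift (ψ F) (pullback.lift s g hs)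
  have h₁ : a ≫ H.σ = p ≫ s := by simpa [ψ] using ha =≫ pullback.fst _ _
  refine ⟨S, p, hp, a, ?_, ?_, by simpa [ψ] using ha =≫ pullback.snd _ _⟩
  · rw [← σ_r₁, reassoc_of% h₁, IsKernelPair.lift_fst]
  · rw [← σ_r₂, reassoc_of% h₁, IsKernelPair.lift_snd]

/-- The diagonal is forced on the cover of `G.obj` by pairs (γ, h) with γ ending at F h; local
fullness supplies the descent. -/
lemma isFinal_of_isIso_of_isRegularEpi (F : H ⟶ G) [IsIso (π₀.map F)] [IsRegularEpi (ψ F)] :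
    IsFinal F := by
  intro X Y K hK U V hUV
  have hUV₀ : U.f₀ ≫ K.f₀ = F.f₀ ≫ V.f₀ := congr_arg Hom.f₀ hUV
  have hUV₁ : U.f₁ ≫ K.f₁ = F.f₁ ≫ V.f₁ := congr_arg Hom.f₁ hUV
  let γ := pullback.fst G.c F.f₀
  let η := pullback.snd G.c F.f₀
  have hγη : γ ≫ G.c = η ≫ F.f₀ := pullback.condition
  have : StrongEpi (γ ≫ G.d) := strongEpi_fst_comp_d F
  -- The unique lift of V γ with codomain U h; its domain is the only possible value of the diagonal
  -- at the domain of γ.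
  let ℓ : pullback G.c F.f₀ ⟶ X.arr := IsPullback.lift hK (γ ≫ V.f₁) (η ≫ U.f₀) (by
    rw [Category.assoc, Category.assoc, ← V.c_comm, hUV₀, reassoc_of% hγη])
  have hℓ₁ : ℓ ≫ K.f₁ = γ ≫ V.f₁ := IsPullback.lift_fst hK _ _ _
  have hℓc : ℓ ≫ X.c = η ≫ U.f₀ := IsPullback.lift_snd hK _ _ _
  have mul_eq : ∀ {T : C} (a b : T ⟶ pullback G.c F.f₀) (z : T ⟶ X.arr) (w : T ⟶ G.arr)
      (_ : z ≫ K.f₁ = w ≫ V.f₁) (hz : a ≫ ℓ ≫ X.c = z ≫ X.d) (_ : z ≫ X.c = b ≫ ℓ ≫ X.c)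
      (hw : a ≫ γ ≫ G.c = w ≫ G.d)
      (_ : G.mul (a ≫ γ) w (by simpa using hw) = b ≫ γ),
      X.mul (a ≫ ℓ) z (by simpa using hz) = b ≫ ℓ := by
    intro T a b z w hzw hz hzb hw hab
    apply hK.arr_ext
    · rw [Category.assoc b, hℓ₁, ← Category.assoc b, ← hab, mul_f₁, mul_f₁]
      exact mul_congr _ (by simp [hℓ₁]) hzw
    · rw [mul_c, hzb, Category.assoc]
  obtain ⟨l₀, hl₀⟩ : ∃ l₀ : G.obj ⟶ X.obj, (γ ≫ G.d) ≫ l₀ = ℓ ≫ X.d := by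
    apply Regular.exists_descent
    intro T a b hab
    -- Two choices with the same domain differ by γ_a⁻¹ · γ_b : F h_a → F h_b. Locally this is F t,
    -- so ℓ_a · U t = ℓ_b and the two lifts have the same domain.
    let g := G.mul (a ≫ γ ≫ G.i) (b ≫ γ) (by simp [G.i_c, hab])
    have hgd : g ≫ G.d = (a ≫ η) ≫ F.f₀ := by simp [g, mul_d, G.i_d, hγη]
    have hgc : g ≫ G.c = (b ≫ η) ≫ F.f₀ := by simp [g, mul_c, hγη]
    obtain ⟨S, p, hp, t, htd, htc, htg⟩ := exists_arr_lift F (a ≫ η) (b ≫ η) g hgd hgc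
    refine ⟨S, p, hp, ?_⟩
    have := mul_eq (p ≫ a) (p ≫ b) (t ≫ U.f₁) (t ≫ F.f₁) (by simp [hUV₁])
      (by simp [hℓc, ← U.d_comm, reassoc_of% htd]) (by simp [hℓc, ← U.c_comm, reassoc_of% htc])
      (by rw [htg, Category.assoc, Category.assoc, hgd, hγη, Category.assoc]) (by
        rw [mul_congr _ (Category.assoc _ _ _) htg, ← precomp_mul p (a ≫ γ) g
          (by simp [hgd, hγη]), Category.assoc p b γ]
        congr 1
        refine Eq.trans (mul_congr _ rfl (mul_congr _ (Category.assoc _ _ _).symm rfl))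
          (mul_inv_mul_cancel (a ≫ γ) (b ≫ γ) (by simpa using hab)))
    have := this =≫ X.d
    rw [mul_d] at this
    simpa using this
  have hl₀K : l₀ ≫ K.f₀ = V.f₀ := by
    rw [← cancel_epi (γ ≫ G.d), ← Category.assoc, hl₀, Category.assoc, K.d_comm,
      reassoc_of% hℓ₁, Category.assoc, V.d_comm]
  let l₁ : G.arr ⟶ X.arr := IsPullback.lift hK V.f₁ (G.c ≫ l₀) (by
    rw [Category.assoc, hl₀K, V.c_comm])
  have hl₁ : l₁ ≫ K.f₁ = V.f₁ := IsPullback.lift_fst hK _ _ _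
  have hl₁c : l₁ ≫ X.c = G.c ≫ l₀ := IsPullback.lift_snd hK _ _ _
  have hl₁d : G.d ≫ l₀ = l₁ ≫ X.d := by
    -- Locally the codomain of an arrow p is the domain of some γ. The lift of p followed by ℓ at γ
    -- is ℓ at p · γ, whose domain is known.
    obtain ⟨S, p, _, b, hb⟩ := Regular.exists_cover_lift (γ ≫ G.d) G.c
    let a : S ⟶ pullback G.c F.f₀ := pullback.lift (G.mul p (b ≫ γ) (by simpa using hb.symm))
      (b ≫ η) (by simp [mul_c, hγη])
    have haγ : a ≫ γ = G.mul p (b ≫ γ) (by simpa using hb.symm) := pullback.lift_fst _ _ _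
    have haη : a ≫ η = b ≫ η := pullback.lift_snd _ _ _
    have hmul : X.mul (p ≫ l₁) (b ≫ ℓ)
        (by rw [Category.assoc, hl₁c, ← reassoc_of% hb, ← Category.assoc γ, hl₀,
          Category.assoc]) = a ≫ ℓ := by
      apply hK.arr_ext
      · rw [Category.assoc a, hℓ₁, ← Category.assoc a, haγ, mul_f₁, mul_f₁]
        exact mul_congr _ (by simp [hl₁]) (by simp [hℓ₁])
      · rw [mul_c, Category.assoc, Category.assoc, hℓc, reassoc_of% haη]
    have h := hmul =≫ X.d
    rw [mul_d, Category.assoc, Category.assoc, ← hl₀, ← Category.assoc a, ← Category.assoc a,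
      haγ, mul_d, Category.assoc] at h
    rw [← cancel_epi p, h]
  obtain ⟨L, hL₀, hL⟩ := hK.exists_lift V l₀ l₁ hl₀K hl₁ hl₁d hl₁c.symm
  refine ⟨L, ⟨hK.hom_ext (by rw [Category.assoc, hL, hUV]) ?_, hL⟩, ?_⟩
  -- At F h the choice γ = 1 is available, and its lift is the identity of U h.
  · let b : H.obj ⟶ pullback G.c F.f₀ := pullback.lift (F.f₀ ≫ G.e) (𝟙 _) (by simp [G.e_c])
    have hbγ : b ≫ γ = F.f₀ ≫ G.e := pullback.lift_fst _ _ _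
    have hbη : b ≫ η = 𝟙 _ := pullback.lift_snd _ _ _
    have hbℓ : b ≫ ℓ = U.f₀ ≫ X.e := by
      apply hK.arr_ext
      · rw [Category.assoc, hℓ₁, reassoc_of% hbγ, Category.assoc, K.e_comm, V.e_comm,
          reassoc_of% hUV₀]
      · rw [Category.assoc, hℓc, reassoc_of% hbη, Category.assoc, X.e_c, Category.comp_id]
    have := b ≫= hl₀
    rw [Category.assoc, reassoc_of% hbγ, reassoc_of% G.e_d, reassoc_of% hbℓ, X.e_d,
      Category.comp_id] at this
    rw [comp_f₀, hL₀, this]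
  -- For any other diagonal M, the arrow M γ lifts V γ and ends at U h, so it equals ℓ.
  · rintro M ⟨hFM, hMK⟩
    refine hK.hom_ext (hMK.trans hL.symm) ?_
    rw [hL₀, ← cancel_epi (γ ≫ G.d), hl₀, Category.assoc, M.d_comm, ← Category.assoc]
    congr 1
    apply hK.arr_ext
    · rw [hℓ₁, Category.assoc, ← comp_f₁, hMK]
    · rw [hℓc, Category.assoc, ← M.c_comm, reassoc_of% hγη, ← comp_f₀, hFM]

end Sufficiency

/-! ### Actions and their discrete fibrations -/

noncomputable section Actions

variable {C : Type u} [Category.{v} C] [HasPullbacks C]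

/-- A (contravariant) action of an internal groupoid: an object over the object of objects,
together with a transport of fibres along arrows, from the codomain to the domain. -/
structure Action (G : InternalGroupoid C) where
  /-- the object acted upon -/
  obj : C
  /-- the structure morphism -/
  p : obj ⟶ G.obj
  /-- the transport -/
  act : pullback G.c p ⟶ obj
  act_p : act ≫ p = pullback.fst G.c p ≫ G.d
  id_act : pullback.lift (p ≫ G.e) (𝟙 obj) (by simp [G.e_c]) ≫ act = 𝟙 obj
  mul_act : ∀ {T : C} (g g' : T ⟶ G.arr) (x : T ⟶ obj) (h : g ≫ G.c = g' ≫ G.d)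
    (h' : g' ≫ G.c = x ≫ p),
    pullback.lift (G.mul g g' h) x ((mul_c g g' h).trans h') ≫ act =
      pullback.lift g (pullback.lift g' x h' ≫ act)
        (by rw [Category.assoc, act_p, pullback.lift_fst_assoc, h]) ≫ act

namespace Action

variable {G : InternalGroupoid C} (A : Action G)

/-- The transport of a generalized element along a generalized arrow. -/
def smul {T : C} (g : T ⟶ G.arr) (x : T ⟶ A.obj) (h : g ≫ G.c = x ≫ A.p) : T ⟶ A.obj :=
  pullback.lift g x h ≫ A.act

variable {A}

lemma smul_p {T : C} (g : T ⟶ G.arr) (x : T ⟶ A.obj) (h : g ≫ G.c = x ≫ A.p) :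
    A.smul g x h ≫ A.p = g ≫ G.d := by
  rw [smul, Category.assoc, A.act_p, pullback.lift_fst_assoc]

lemma smul_congr {T : C} {g g' : T ⟶ G.arr} {x x' : T ⟶ A.obj} (h : g ≫ G.c = x ≫ A.p)
    (hg : g = g') (hx : x = x') : A.smul g x h = A.smul g' x' (by rw [← hg, ← hx, h]) := by
  subst hg hx; rfl

lemma comp_act {T : C} (z : T ⟶ pullback G.c A.p) :
    z ≫ A.act = A.smul (z ≫ pullback.fst _ _) (z ≫ pullback.snd _ _)
      (by simp [pullback.condition]) := by
  rw [smul]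
  congr 1
  apply pullback.hom_ext <;> simp

lemma smul_of_eq_id {T : C} {g : T ⟶ G.arr} {x : T ⟶ A.obj} (h : g ≫ G.c = x ≫ A.p)
    (hg : g = x ≫ A.p ≫ G.e) : A.smul g x h = x := by
  have := x ≫= A.id_act
  rw [Category.comp_id x, ← Category.assoc x (pullback.lift _ _ _), comp_act] at this
  exact (smul_congr _ (by simp [hg]) (by simp)).trans this

lemma smul_smul {T : C} (g g' : T ⟶ G.arr) (x : T ⟶ A.obj) (h : g ≫ G.c = g' ≫ G.d)
    (h' : g' ≫ G.c = x ≫ A.p) :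
    A.smul g (A.smul g' x h') (by rw [smul_p, h]) =
      A.smul (G.mul g g' h) x ((mul_c g g' h).trans h') :=
  (A.mul_act g g' x h h').symm

variable (A)

/-- The composition of the action groupoid. -/
def groupoidM : pullback (pullback.snd G.c A.p) A.act ⟶ pullback G.c A.p :=
  pullback.lift
    (G.mul (pullback.fst _ _ ≫ pullback.fst _ _) (pullback.snd _ _ ≫ pullback.fst _ _) (by
      rw [Category.assoc, Category.assoc, pullback.condition, pullback.condition_assoc, A.act_p]))
    (pullback.snd _ _ ≫ pullback.snd _ _) (by
      rw [mul_c, Category.assoc, Category.assoc, pullback.condition])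

lemma lift_groupoidM_fst {T : C} (x y : T ⟶ pullback G.c A.p)
    (h : x ≫ pullback.snd G.c A.p = y ≫ A.act) :
    (pullback.lift x y h ≫ A.groupoidM) ≫ pullback.fst G.c A.p =
      G.mul (x ≫ pullback.fst _ _) (y ≫ pullback.fst _ _) (by
        rw [Category.assoc, Category.assoc, pullback.condition, reassoc_of% h, A.act_p]) := by
  rw [groupoidM, Category.assoc, pullback.lift_fst, precomp_mul]
  exact mul_congr _ (by simp) (by simp)

lemma lift_groupoidM_snd {T : C} (x y : T ⟶ pullback G.c A.p)
    (h : x ≫ pullback.snd G.c A.p = y ≫ A.act) :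
    (pullback.lift x y h ≫ A.groupoidM) ≫ pullback.snd G.c A.p =
      y ≫ pullback.snd _ _ := by
  rw [groupoidM, Category.assoc, pullback.lift_snd, pullback.lift_snd_assoc]

lemma inv_smul_condition :
    (pullback.fst G.c A.p ≫ G.i) ≫ G.c = A.act ≫ A.p := by
  rw [Category.assoc, G.i_c, A.act_p]

/-- The action groupoid (internal category of elements) of an action. -/
def groupoid : InternalGroupoid C where
  obj := A.obj
  arr := pullback G.c A.p
  d := A.act
  c := pullback.snd G.c A.p
  e := pullback.lift (A.p ≫ G.e) (𝟙 A.obj) (by simp [G.e_c])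
  m := A.groupoidM
  i := pullback.lift (pullback.fst _ _ ≫ G.i) A.act A.inv_smul_condition
  e_d := A.id_act
  e_c := by simp
  m_d := by
    have h : (pullback.fst (pullback.snd G.c A.p) A.act ≫ pullback.fst _ _) ≫ G.c =
        (pullback.snd _ _ ≫ pullback.fst _ _) ≫ G.d := by
      rw [Category.assoc, Category.assoc, pullback.condition, pullback.condition_assoc, A.act_p]
    rw [comp_act, comp_act]
    refine (smul_congr _ (pullback.lift_fst _ _ _) (pullback.lift_snd _ _ _)).trans ?_
    rw [← smul_smul _ _ _ h (by simp [pullback.condition])]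
    exact smul_congr _ rfl ((comp_act _).symm.trans pullback.condition.symm)
  m_c := by rw [groupoidM, pullback.lift_snd]
  id_m := by
    apply pullback.hom_ext
    · rw [lift_groupoidM_fst]
      refine (mul_of_eq_id_left _ ?_).trans rfl
      rw [Category.assoc, pullback.lift_fst, reassoc_of% A.act_p, Category.id_comp]
    · rw [lift_groupoidM_snd]
  m_id := by
    apply pullback.hom_ext
    · rw [lift_groupoidM_fst]
      refine (mul_of_eq_id_right _ ?_).trans rfl
      rw [Category.assoc, pullback.lift_fst, Category.id_comp, pullback.condition_assoc]
    · rw [lift_groupoidM_snd]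
      simp
  assoc x y z hxy hyz := by
    have cond : ∀ {T : C} {x y : T ⟶ pullback G.c A.p}
        (_ : x ≫ pullback.snd G.c A.p = y ≫ A.act),
        (x ≫ pullback.fst G.c A.p) ≫ G.c = (y ≫ pullback.fst G.c A.p) ≫ G.d := by
      intro T x y h
      rw [Category.assoc, Category.assoc, pullback.condition, reassoc_of% h, A.act_p]
    apply pullback.hom_ext
    · refine (lift_groupoidM_fst _ _ _ _).trans (Eq.trans ?_ (lift_groupoidM_fst _ _ _ _).symm)
      exact (mul_congr _ (lift_groupoidM_fst _ _ _ _) rfl).trans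
        ((InternalGroupoid.mul_assoc _ _ _ (cond hxy) (cond hyz)).trans
          (mul_congr _ rfl (lift_groupoidM_fst _ _ _ _).symm))
    · rw [lift_groupoidM_snd, lift_groupoidM_snd, lift_groupoidM_snd]
  i_d := by
    change A.smul _ _ _ = _
    have h := smul_smul (A := A) (pullback.fst G.c A.p ≫ G.i) (pullback.fst G.c A.p)
      (pullback.snd G.c A.p) (by simp [G.i_c]) pullback.condition
    refine (smul_congr _ rfl ?_).trans (h.trans (smul_of_eq_id _ ?_))
    · rw [← Category.id_comp A.act, comp_act]
      exact smul_congr _ (Category.id_comp _) (Category.id_comp _)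
    · rw [inv_mul_self, pullback.condition_assoc]
  i_c := by simp
  m_inv := by
    apply pullback.hom_ext
    · rw [lift_groupoidM_fst]
      refine (mul_congr _ (Category.id_comp _) (pullback.lift_fst _ _ _)).trans
        ((mul_inv_self _).trans ?_)
      rw [Category.assoc, pullback.lift_fst, reassoc_of% A.act_p]
    · rw [lift_groupoidM_snd]
      simp
  inv_m := by
    apply pullback.hom_ext
    · rw [lift_groupoidM_fst]
      refine (mul_congr _ (pullback.lift_fst _ _ _) (Category.id_comp _)).trans
        ((inv_mul_self _).trans ?_)
      rw [Category.assoc, pullback.lift_fst, pullback.condition_assoc]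
    · rw [lift_groupoidM_snd]
      simp

/-- The projection of the action groupoid. -/
def proj : A.groupoid ⟶ G :=
  { f₀ := A.p
    f₁ := pullback.fst G.c A.p
    d_comm := A.act_p
    c_comm := pullback.condition.symm
    e_comm := pullback.lift_fst _ _ _
    m_comm := pullback.lift_fst _ _ _ }

lemma proj_isDiscreteFibration : IsDiscreteFibration A.proj :=
  IsPullback.of_hasPullback G.c A.p

end Action

end Actions

/-! ### Orbits of an action -/

noncomputable section Orbits

variable {C : Type u} [Category.{v} C] [BarrExact C]

namespace Action

variable {H : InternalGroupoid C} (A : Action H)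

/-- The object of orbits of an action. -/
def orbits : C := π₀.obj A.groupoid

/-- The quotient morphism to the object of orbits. -/
def toOrbits : A.obj ⟶ A.orbits := A.groupoid.toπ₀

instance : IsRegularEpi A.toOrbits := inferInstanceAs (IsRegularEpi A.groupoid.toπ₀)

variable {A}

lemma smul_toOrbits {T : C} (g : T ⟶ H.arr) (x : T ⟶ A.obj) (h : g ≫ H.c = x ≫ A.p) :
    A.smul g x h ≫ A.toOrbits = x ≫ A.toOrbits := by
  have key : A.act ≫ A.toOrbits = pullback.snd H.c A.p ≫ A.toOrbits := A.groupoid.d_toπ₀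
  rw [smul, Category.assoc, key, pullback.lift_snd_assoc]

lemma exists_orbits_desc {Z : C} (f : A.obj ⟶ Z) (hf : A.act ≫ f = pullback.snd H.c A.p ≫ f) :
    ∃ g : A.orbits ⟶ Z, A.toOrbits ≫ g = f :=
  exists_π₀_desc (H := A.groupoid) f hf

/-- Generalized elements in the same orbit are locally related by a transport. -/
lemma exists_smul_eq {T : C} (x y : T ⟶ A.obj) (h : x ≫ A.toOrbits = y ≫ A.toOrbits) :
    ∃ (S : C) (p : S ⟶ T) (_ : StrongEpi p) (g : S ⟶ H.arr) (hg : g ≫ H.c = (p ≫ y) ≫ A.p),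
      A.smul g (p ≫ y) hg = p ≫ x := by
  obtain ⟨S, p, hp, a, ha, ha'⟩ := exists_arr_of_toπ₀_eq (H := A.groupoid) x y h
  let b : S ⟶ pullback H.c A.p := a
  replace ha : b ≫ A.act = p ≫ x := ha
  replace ha' : b ≫ pullback.snd H.c A.p = p ≫ y := ha'
  refine ⟨S, p, hp, b ≫ pullback.fst H.c A.p, ?_, ?_⟩
  · rw [← ha', Category.assoc, Category.assoc, pullback.condition]
  · rw [← ha, comp_act]
    exact smul_congr _ rfl ha'.symm

end Action

/-! ### The comma object and its action by `H` -/

variable {H G : InternalGroupoid C} (F : H ⟶ G)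

/-- The action of `H` on the object of pairs of an object `h` of `H` and an arrow of `G` with
domain `F h`, by precomposition. -/
def commaAction : Action H where
  obj := pullback F.f₀ G.d
  p := pullback.fst _ _
  act := pullback.lift (pullback.fst _ _ ≫ H.d)
    (G.mul (pullback.fst _ _ ≫ F.f₁) (pullback.snd _ _ ≫ pullback.snd _ _) (by
      rw [Category.assoc, Category.assoc, ← F.c_comm, ← pullback.condition,
        pullback.condition_assoc]))
    (by rw [mul_d, Category.assoc, Category.assoc, F.d_comm])
  act_p := pullback.lift_fst _ _ _
  id_act := by
    apply pullback.hom_ext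
    · simp [H.e_d]
    · rw [Category.assoc, pullback.lift_snd, precomp_mul]
      refine (mul_of_eq_id_left _ ?_).trans (by simp)
      simp [F.e_comm, pullback.condition_assoc]
  mul_act g g' x h h' := by
    apply pullback.hom_ext
    · simp [mul_d]
    · simp only [Category.assoc, pullback.lift_snd, precomp_mul]
      refine (mul_congr _ (by simp [mul_f₁]) (by simp)).trans ((mul_assoc (g ≫ F.f₁) (g' ≫ F.f₁)
        (x ≫ pullback.snd _ _) (by simp [← F.c_comm, ← F.d_comm, reassoc_of% h])
        (by simp [← F.c_comm, reassoc_of% h', pullback.condition])).trans ?_)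
      exact mul_congr _ (by simp) (by simp [precomp_mul])

/-- The arrow component of an element of the object acted upon by `commaAction F`. -/
def commaArr : (commaAction F).obj ⟶ G.arr := pullback.snd F.f₀ G.d

lemma commaArr_d : commaArr F ≫ G.d = (commaAction F).p ≫ F.f₀ := pullback.condition.symm

variable {F}

lemma comma_ext {T : C} {x y : T ⟶ (commaAction F).obj}
    (h : x ≫ (commaAction F).p = y ≫ (commaAction F).p)
    (harr : x ≫ commaArr F = y ≫ commaArr F) : x = y :=
  pullback.hom_ext h harr

/-- Construction of generalized elements of the object acted upon by `commaAction F`. -/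
def commaMk {T : C} (h : T ⟶ H.obj) (γ : T ⟶ G.arr) (w : h ≫ F.f₀ = γ ≫ G.d) :
    T ⟶ (commaAction F).obj :=
  pullback.lift h γ w

lemma commaMk_p {T : C} (h : T ⟶ H.obj) (γ : T ⟶ G.arr) (w : h ≫ F.f₀ = γ ≫ G.d) :
    commaMk h γ w ≫ (commaAction F).p = h :=
  pullback.lift_fst _ _ _

lemma commaMk_arr {T : C} (h : T ⟶ H.obj) (γ : T ⟶ G.arr) (w : h ≫ F.f₀ = γ ≫ G.d) :
    commaMk h γ w ≫ commaArr F = γ :=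
  pullback.lift_snd _ _ _

lemma smul_commaArr {T : C} (η : T ⟶ H.arr) (x : T ⟶ (commaAction F).obj)
    (h : η ≫ H.c = x ≫ (commaAction F).p) :
    (commaAction F).smul η x h ≫ commaArr F =
      G.mul (η ≫ F.f₁) (x ≫ commaArr F) (by
        rw [Category.assoc, Category.assoc, ← F.c_comm, commaArr_d, reassoc_of% h]) := by
  refine (Category.assoc _ _ _).trans ((congr_arg (_ ≫ ·) (pullback.lift_snd _ _ _)).trans ?_)
  refine (precomp_mul _ _ _ _).trans (mul_congr _ ?_ ?_)
  · exact pullback.lift_fst_assoc _ _ _ _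
  · exact pullback.lift_snd_assoc _ _ _ _

/-- Postcomposition of the arrow component with the inverse of an arrow. -/
def shift {T : C} (x : T ⟶ (commaAction F).obj) (g : T ⟶ G.arr)
    (h : g ≫ G.c = x ≫ commaArr F ≫ G.c) : T ⟶ (commaAction F).obj :=
  commaMk (x ≫ (commaAction F).p) (G.mul (x ≫ commaArr F) (g ≫ G.i) (by simp [G.i_d, h]))
    (by rw [mul_d, Category.assoc, Category.assoc, commaArr_d])

lemma shift_p {T : C} (x : T ⟶ (commaAction F).obj) (g : T ⟶ G.arr)
    (h : g ≫ G.c = x ≫ commaArr F ≫ G.c) :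
    shift x g h ≫ (commaAction F).p = x ≫ (commaAction F).p :=
  commaMk_p _ _ _

lemma shift_arr {T : C} (x : T ⟶ (commaAction F).obj) (g : T ⟶ G.arr)
    (h : g ≫ G.c = x ≫ commaArr F ≫ G.c) :
    shift x g h ≫ commaArr F = G.mul (x ≫ commaArr F) (g ≫ G.i) (by simp [G.i_d, h]) :=
  commaMk_arr _ _ _

lemma shift_congr {T : C} {x x' : T ⟶ (commaAction F).obj} {g g' : T ⟶ G.arr}
    (h : g ≫ G.c = x ≫ commaArr F ≫ G.c) (hx : x = x') (hg : g = g') :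
    shift x g h = shift x' g' (by rw [← hx, ← hg, h]) := by
  subst hx hg; rfl

lemma precomp_shift {S T : C} (t : S ⟶ T) (x : T ⟶ (commaAction F).obj) (g : T ⟶ G.arr)
    (h : g ≫ G.c = x ≫ commaArr F ≫ G.c) :
    t ≫ shift x g h = shift (t ≫ x) (t ≫ g) (by simp [h]) := by
  apply comma_ext
  · rw [Category.assoc, shift_p, shift_p, Category.assoc]
  · rw [Category.assoc, shift_arr, shift_arr, precomp_mul]
    exact mul_congr _ (by simp) (by simp)

/-- Transport by `H` commutes with postcomposition. -/
lemma smul_shift {T : C} (η : T ⟶ H.arr) (x : T ⟶ (commaAction F).obj) (g : T ⟶ G.arr)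
    (h : g ≫ G.c = x ≫ commaArr F ≫ G.c) (hη : η ≫ H.c = x ≫ (commaAction F).p) :
    (commaAction F).smul η (shift x g h) (by rw [shift_p, hη]) =
      shift ((commaAction F).smul η x hη) g
        (by rw [reassoc_of% smul_commaArr, mul_c, h, Category.assoc]) := by
  apply comma_ext
  · rw [Action.smul_p, shift_p, Action.smul_p]
  · refine (smul_commaArr _ _ _).trans ((mul_congr _ rfl (shift_arr _ _ _)).trans
      (Eq.trans ?_ (shift_arr _ _ _).symm))
    rw [← mul_assoc _ _ _ (by
      rw [Category.assoc, Category.assoc, ← F.c_comm, commaArr_d, reassoc_of% hη])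
      (by simp [G.i_d, h])]
    exact mul_congr _ (smul_commaArr _ _ _).symm rfl

/-- Postcomposition is well defined on orbits. -/
lemma shift_toOrbits {T : C} {x y : T ⟶ (commaAction F).obj} (g : T ⟶ G.arr)
    (hx : g ≫ G.c = x ≫ commaArr F ≫ G.c) (hy : g ≫ G.c = y ≫ commaArr F ≫ G.c)
    (h : x ≫ (commaAction F).toOrbits = y ≫ (commaAction F).toOrbits) :
    shift x g hx ≫ (commaAction F).toOrbits = shift y g hy ≫ (commaAction F).toOrbits := by
  obtain ⟨S, p, _, η, hη, hs⟩ := Action.exists_smul_eq x y h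
  rw [← cancel_epi p, ← Category.assoc, ← Category.assoc, precomp_shift, precomp_shift,
    ← Action.smul_toOrbits η (shift (p ≫ y) (p ≫ g) (by simp [hy])) (by rw [shift_p, hη]),
    smul_shift _ _ _ _ hη]
  congr 1
  exact shift_congr _ hs.symm rfl

/-! ### The action of `G` on orbits and the comprehensive factorization -/

variable (F)

/-- Precomposition leaves the codomain of the arrow component unchanged, so that codomain is
constant on orbits. -/
lemma exists_orbitsBase :
    ∃ q : (commaAction F).orbits ⟶ G.obj, (commaAction F).toOrbits ≫ q = commaArr F ≫ G.c := by
  apply Action.exists_orbits_desc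
  rw [← Category.id_comp (commaAction F).act, Action.comp_act, reassoc_of% smul_commaArr, mul_c]
  simp

/-- The structure morphism of the object of orbits of `commaAction F`. -/
def orbitsBase : (commaAction F).orbits ⟶ G.obj := (exists_orbitsBase F).choose

lemma toOrbits_orbitsBase : (commaAction F).toOrbits ≫ orbitsBase F = commaArr F ≫ G.c :=
  (exists_orbitsBase F).choose_spec

/-- Transport is defined on representatives by `shift` and descends because `shift_toOrbits` makes
the result independent of the representative. -/
lemma exists_orbitsAct : ∃ a : pullback G.c (orbitsBase F) ⟶ (commaAction F).orbits,
    ∀ {T : C} (x : T ⟶ (commaAction F).obj) (g : T ⟶ G.arr)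
      (h : g ≫ G.c = x ≫ commaArr F ≫ G.c),
      pullback.lift g (x ≫ (commaAction F).toOrbits)
        (by rw [h, Category.assoc, toOrbits_orbitsBase]) ≫ a =
      shift x g h ≫ (commaAction F).toOrbits := by
  let q := (commaAction F).toOrbits
  -- The cover z₀ of the object of pairs (arrow, orbit) adjoins a representative x₀ of the orbit.
  let x₀ := pullback.fst q (pullback.snd G.c (orbitsBase F))
  let z₀ := pullback.snd q (pullback.snd G.c (orbitsBase F))
  have hxz : x₀ ≫ q = z₀ ≫ pullback.snd _ _ := pullback.condition
  have h₀ : (z₀ ≫ pullback.fst _ _) ≫ G.c = x₀ ≫ commaArr F ≫ G.c := by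
    rw [Category.assoc, pullback.condition, ← reassoc_of% hxz, toOrbits_orbitsBase]
  obtain ⟨a, ha⟩ := Regular.exists_descent z₀ (shift x₀ (z₀ ≫ pullback.fst _ _) h₀ ≫ q) (by
    intro T s t hst
    refine ⟨T, 𝟙 T, inferInstance, ?_⟩
    rw [Category.id_comp, Category.id_comp, ← Category.assoc, ← Category.assoc, precomp_shift,
      precomp_shift]
    have h' := shift_toOrbits (x := s ≫ x₀) (y := t ≫ x₀) (s ≫ z₀ ≫ pullback.fst _ _)
      (by simpa using s ≫= h₀) (by rw [reassoc_of% hst]; simpa using t ≫= h₀)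
      (by rw [Category.assoc, Category.assoc, hxz, reassoc_of% hst])
    refine h'.trans ?_
    congr 1
    exact shift_congr _ rfl (by rw [reassoc_of% hst]))
  refine ⟨a, fun x g h => ?_⟩
  let y := pullback.lift g (x ≫ q) (by rw [h, Category.assoc, toOrbits_orbitsBase])
  let w := pullback.lift x y (pullback.lift_snd _ _ _).symm
  have hwx : w ≫ x₀ = x := pullback.lift_fst _ _ _
  have hwz : w ≫ z₀ = y := pullback.lift_snd _ _ _
  have hyg : y ≫ pullback.fst _ _ = g := pullback.lift_fst _ _ _
  have := w ≫= ha
  rw [← Category.assoc, ← Category.assoc, hwz, precomp_shift] at this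
  refine this.trans ?_
  congr 1
  exact shift_congr _ hwx (by rw [reassoc_of% hwz, hyg])

/-- The transport of orbits of `commaAction F` along arrows of `G`. -/
def orbitsAct : pullback G.c (orbitsBase F) ⟶ (commaAction F).orbits :=
  (exists_orbitsAct F).choose

variable {F}

lemma lift_orbitsAct {T : C} (x : T ⟶ (commaAction F).obj) (g : T ⟶ G.arr)
    (y : T ⟶ (commaAction F).orbits) (h : g ≫ G.c = x ≫ commaArr F ≫ G.c)
    (hy : y = x ≫ (commaAction F).toOrbits) (hgy : g ≫ G.c = y ≫ orbitsBase F) :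
    pullback.lift g y hgy ≫ orbitsAct F = shift x g h ≫ (commaAction F).toOrbits := by
  subst hy
  exact (exists_orbitsAct F).choose_spec x g h

/-- Computes transport of an orbit that has a representative only after restriction along t; the
action axioms are checked this way and then a cover is cancelled. -/
lemma precomp_lift_orbitsAct {S T : C} (t : S ⟶ T) (x : S ⟶ (commaAction F).obj)
    (g : T ⟶ G.arr) (y : T ⟶ (commaAction F).orbits)
    (h : t ≫ g ≫ G.c = x ≫ commaArr F ≫ G.c)
    (hy : t ≫ y = x ≫ (commaAction F).toOrbits) (hgy : g ≫ G.c = y ≫ orbitsBase F) :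
    t ≫ pullback.lift g y hgy ≫ orbitsAct F =
      shift x (t ≫ g) (by rw [Category.assoc, h]) ≫ (commaAction F).toOrbits := by
  rw [← lift_orbitsAct x (t ≫ g) (t ≫ y) (by rw [Category.assoc, h]) hy (by simp [hgy]),
    ← Category.assoc]
  congr 1
  apply pullback.hom_ext <;> simp

lemma lift_orbitsAct_orbitsBase {T : C} (g : T ⟶ G.arr) (y : T ⟶ (commaAction F).orbits)
    (hgy : g ≫ G.c = y ≫ orbitsBase F) :
    (pullback.lift g y hgy ≫ orbitsAct F) ≫ orbitsBase F = g ≫ G.d := by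
  obtain ⟨S, p, _, x, hx⟩ := Regular.exists_cover_lift (commaAction F).toOrbits y
  have h : p ≫ g ≫ G.c = x ≫ commaArr F ≫ G.c := by
    rw [hgy, ← toOrbits_orbitsBase, reassoc_of% hx]
  rw [← cancel_epi p, ← Category.assoc, precomp_lift_orbitsAct p x g y h hx.symm hgy,
    Category.assoc, toOrbits_orbitsBase, ← Category.assoc, shift_arr, mul_c]
  simp [G.i_c]

variable (F)

/-- The action of `G` on the orbits of `commaAction F`; its action groupoid is the middle object
of the comprehensive factorization of `F`. -/
def orbitsAction : Action G where
  obj := (commaAction F).orbits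
  p := orbitsBase F
  act := orbitsAct F
  act_p := by
    have := lift_orbitsAct_orbitsBase (F := F) (pullback.fst G.c (orbitsBase F))
      (pullback.snd _ _) pullback.condition
    rw [← this]
    congr 1
    refine (Category.id_comp _).symm.trans ?_
    congr 1
    apply pullback.hom_ext <;> simp
  id_act := by
    have h : commaArr F ≫ G.c = (commaAction F).toOrbits ≫ orbitsBase F :=
      (toOrbits_orbitsBase F).symm
    rw [← cancel_epi (commaAction F).toOrbits,
      precomp_lift_orbitsAct _ (𝟙 _) _ _ (by simp [G.e_c, h]) (by simp)]
    refine Eq.trans ?_ ((Category.id_comp _).trans (Category.comp_id _).symm)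
    congr 1
    apply comma_ext
    · rw [shift_p]
    · rw [shift_arr]
      exact mul_of_eq_id_right _ (by simp [inv_of_id, reassoc_of% h])
  mul_act g g' y h h' := by
    obtain ⟨S, p, _, x, hx⟩ := Regular.exists_cover_lift (commaAction F).toOrbits y
    have hg' : p ≫ g' ≫ G.c = x ≫ commaArr F ≫ G.c := by
      rw [h', ← toOrbits_orbitsBase, reassoc_of% hx]
    rw [← cancel_epi p, precomp_lift_orbitsAct p x _ y (by rw [mul_c, hg']) hx.symm,
      precomp_lift_orbitsAct p (shift x (p ≫ g') (by simp [hg'])) g _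
        (by rw [reassoc_of% shift_arr, mul_c]; simp [G.i_c, h])
        (precomp_lift_orbitsAct p x g' y hg' hx.symm h')]
    congr 1
    apply comma_ext
    · rw [shift_p, shift_p, shift_p]
    · rw [shift_arr, shift_arr]
      refine Eq.trans ?_ (mul_congr (by rw [mul_c]; simp [G.i_c, G.i_d, h])
        (shift_arr _ _ _).symm rfl)
      rw [mul_assoc _ _ _ (by simp [G.i_d, hg']) (by simp [G.i_d, G.i_c, h])]
      refine mul_congr _ rfl ?_
      rw [Category.assoc, inv_mul, precomp_mul]
      exact mul_congr _ (by simp) (by simp)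

/-- The element of the comma object given by identity arrows. -/
def commaId : H.obj ⟶ (commaAction F).obj :=
  commaMk (𝟙 _) (F.f₀ ≫ G.e) (by simp [G.e_d])

lemma commaId_p : commaId F ≫ (commaAction F).p = 𝟙 _ := commaMk_p _ _ _

lemma commaId_arr : commaId F ≫ commaArr F = F.f₀ ≫ G.e := commaMk_arr _ _ _

lemma commaId_arr_c : commaId F ≫ commaArr F ≫ G.c = F.f₀ := by
  rw [reassoc_of% commaId_arr, G.e_c, Category.comp_id]

/-- The first factor of the comprehensive factorization. -/
lemma exists_comprehensive_factor :
    ∃ U : H ⟶ (orbitsAction F).groupoid,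
      U.f₀ = commaId F ≫ (commaAction F).toOrbits ∧ U ≫ (orbitsAction F).proj = F := by
  have h₀ : (commaId F ≫ (commaAction F).toOrbits) ≫ orbitsBase F = F.f₀ := by
    rw [Category.assoc, toOrbits_orbitsBase, commaId_arr_c]
  have hc : F.f₁ ≫ G.c = (H.c ≫ commaId F ≫ (commaAction F).toOrbits) ≫ orbitsBase F := by
    rw [Category.assoc, h₀, F.c_comm]
  have hs : F.f₁ ≫ G.c = (H.c ≫ commaId F) ≫ commaArr F ≫ G.c := by
    rw [Category.assoc, commaId_arr_c, F.c_comm]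
  have hp : 𝟙 H.arr ≫ H.c = shift (H.c ≫ commaId F) F.f₁ hs ≫ (commaAction F).p := by
    rw [shift_p, Category.assoc, commaId_p, Category.id_comp, Category.comp_id]
  -- For the generic η : h → h', acting on (h', (F η)⁻¹) gives (h, F η · (F η)⁻¹) = (h, 1).
  have key : H.d ≫ commaId F =
      (commaAction F).smul (𝟙 H.arr) (shift (H.c ≫ commaId F) F.f₁ hs) hp := by
    apply comma_ext
    · rw [Action.smul_p, Category.assoc, commaId_p, Category.id_comp, Category.comp_id]
    · have harr : shift (H.c ≫ commaId F) F.f₁ hs ≫ commaArr F = F.f₁ ≫ G.i :=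
        (shift_arr _ _ _).trans (mul_of_eq_id_left _
          (by simp [commaId_arr, reassoc_of% F.c_comm, reassoc_of% G.i_d]))
      refine Eq.trans ?_ ((mul_inv_self F.f₁).symm.trans ((mul_congr _
        (Category.id_comp F.f₁).symm harr.symm).trans (smul_commaArr _ _ _).symm))
      rw [Category.assoc, commaId_arr, reassoc_of% F.d_comm]
  have hd : H.d ≫ commaId F ≫ (commaAction F).toOrbits =
      shift (H.c ≫ commaId F) F.f₁ hs ≫ (commaAction F).toOrbits := by
    rw [← Category.assoc, key, Action.smul_toOrbits]
  exact (orbitsAction F).proj_isDiscreteFibration.exists_lift F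
    (commaId F ≫ (commaAction F).toOrbits)
    (pullback.lift F.f₁ (H.c ≫ commaId F ≫ (commaAction F).toOrbits) hc) h₀
    (pullback.lift_fst _ _ _)
    (hd.trans (lift_orbitsAct _ F.f₁ _ hs (Category.assoc _ _ _).symm hc).symm)
    (pullback.lift_snd _ _ _).symm

/-! ### Final functors are locally full -/

variable {F}

/-- A final functor is locally full. -/
lemma IsFinal.exists_arr_lift (hF : IsFinal F) {T : C} (x y : T ⟶ H.obj) (g : T ⟶ G.arr)
    (hd : g ≫ G.d = x ≫ F.f₀) (hc : g ≫ G.c = y ≫ F.f₀) :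
    ∃ (S : C) (p : S ⟶ T) (_ : StrongEpi p) (a : S ⟶ H.arr),
      a ≫ H.d = p ≫ x ∧ a ≫ H.c = p ≫ y ∧ a ≫ F.f₁ = p ≫ g := by
  obtain ⟨U, hU₀, hU⟩ := exists_comprehensive_factor F
  obtain ⟨L, ⟨hFL, hL⟩, -⟩ := hF (orbitsAction F).proj (orbitsAction F).proj_isDiscreteFibration U
    (𝟙 G) (by rw [hU, Category.comp_id])
  let l₀ : G.obj ⟶ (commaAction F).orbits := L.f₀
  let l₁ : G.arr ⟶ pullback G.c (orbitsBase F) := L.f₁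
  have hl₀ : F.f₀ ≫ l₀ = commaId F ≫ (commaAction F).toOrbits :=
    (congr_arg Hom.f₀ hFL).trans hU₀
  have hl₁ : l₁ ≫ pullback.fst G.c (orbitsBase F) = 𝟙 _ := congr_arg Hom.f₁ hL
  have hl₁c : G.c ≫ l₀ = l₁ ≫ pullback.snd G.c (orbitsBase F) := L.c_comm
  have hl₁d : G.d ≫ l₀ = l₁ ≫ orbitsAct F := L.d_comm
  have hs : g ≫ G.c = (y ≫ commaId F) ≫ commaArr F ≫ G.c := by
    rw [Category.assoc, commaId_arr_c, hc]
  have hgl : g ≫ l₁ = pullback.lift g (y ≫ commaId F ≫ (commaAction F).toOrbits)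
      (by rw [hs, Category.assoc, Category.assoc, Category.assoc, toOrbits_orbitsBase]) := by
    apply pullback.hom_ext
    · simp [hl₁]
    · rw [Category.assoc, ← hl₁c, reassoc_of% hc, hl₀, pullback.lift_snd]
  -- The section L respects transport along g, which yields [x, 1] = [y, g⁻¹].
  have key : (x ≫ commaId F) ≫ (commaAction F).toOrbits =
      shift (y ≫ commaId F) g hs ≫ (commaAction F).toOrbits := by
    rw [← lift_orbitsAct (y ≫ commaId F) g _ hs (Category.assoc _ _ _).symm
      (by rw [hs, Category.assoc, Category.assoc, Category.assoc, toOrbits_orbitsBase]), ← hgl,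
      Category.assoc, Category.assoc, ← hl₀, ← hl₁d, reassoc_of% hd]
  obtain ⟨S, p, hp, η, hη, hηs⟩ := Action.exists_smul_eq _ _ key
  have h₁ := hηs =≫ (commaAction F).p
  have h₂ := hηs =≫ commaArr F
  have hηd : η ≫ H.d = p ≫ x := by
    rw [Action.smul_p] at h₁
    simpa [commaId_p] using h₁
  have hηc : η ≫ H.c = p ≫ y := by
    rw [hη, Category.assoc, shift_p, Category.assoc, commaId_p, Category.comp_id]
  refine ⟨S, p, hp, η, hηd, hηc, ?_⟩
  have hshift : (p ≫ shift (y ≫ commaId F) g hs) ≫ commaArr F = p ≫ g ≫ G.i := by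
    rw [Category.assoc, shift_arr]
    congr 1
    exact mul_of_eq_id_left _ (by simp [commaId_arr, reassoc_of% G.i_d, reassoc_of% hc])
  have hηg : (η ≫ F.f₁) ≫ G.c = (p ≫ g ≫ G.i) ≫ G.d := by
    simp [G.i_d, ← F.c_comm, reassoc_of% hηc, hc]
  -- The arrow η relating the two representatives satisfies F η · g⁻¹ = 1.
  have hinv : p ≫ g ≫ G.i = (η ≫ F.f₁) ≫ G.i := by
    apply eq_inv_of_mul_eq hηg
    rw [smul_commaArr] at h₂
    refine (mul_congr _ rfl hshift.symm).trans (h₂.trans ?_)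
    simp [commaId_arr, ← reassoc_of% F.d_comm, reassoc_of% hηd]
  have := hinv =≫ G.i
  simpa [i_i] using this.symm

/-- The comparison morphism of a final functor is a regular epimorphism. -/
lemma IsFinal.isRegularEpi_ψ (hF : IsFinal F) : IsRegularEpi (ψ F) := by
  let s := pullback.fst (suppMap F) G.σ
  let g := pullback.snd (suppMap F) G.σ
  have hsg : s ≫ suppMap F = g ≫ G.σ := pullback.condition
  -- Local fullness at the generic point (s, g) of the pullback gives a cover p that factors through
  -- `ψ F`.
  obtain ⟨S, p, _, a, had, hac, hag⟩ := hF.exists_arr_lift (s ≫ H.r₁) (s ≫ H.r₂) g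
    (by rw [← σ_r₁, ← reassoc_of% hsg, suppMap_r₁, Category.assoc])
    (by rw [← σ_r₂, ← reassoc_of% hsg, suppMap_r₂, Category.assoc])
  have hψ : a ≫ ψ F = p := by
    apply pullback.hom_ext
    · rw [ψ, Category.assoc, pullback.lift_fst]
      apply supp_hom_ext
      · rw [Category.assoc, σ_r₁, had, Category.assoc]
      · rw [Category.assoc, σ_r₂, hac, Category.assoc]
    · rw [ψ, Category.assoc, pullback.lift_snd, hag]
  have : StrongEpi (a ≫ ψ F) := hψ ▸ inferInstance
  have : StrongEpi (ψ F) := strongEpi_of_strongEpi a _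
  infer_instance

end Orbits

end InternalGroupoid

theorem corollary4p3 {C : Type u} [Category.{v} C] [BarrExact C]
    {H G : InternalGroupoid C} (F : H ⟶ G) :
    InternalGroupoid.IsFinal F ↔
      IsIso (InternalGroupoid.π₀.map F) ∧ IsRegularEpi (InternalGroupoid.ψ F) :=
  ⟨fun hF => ⟨hF.isIso_π₀_map, hF.isRegularEpi_ψ⟩,
    fun ⟨_, _⟩ => InternalGroupoid.isFinal_of_isIso_of_isRegularEpi F⟩
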